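/- A \emph{Polish Lie ring} is a Lie ring $L$ equipped with a Polish (separable, completely metrizable) topology for which addition, negation and the bracket $L \times L \to L$ are continuous. A Polish Lie ring $R$ is \emph{algebraically determined} if, for every Polish Lie ring $S$, every abstract Lie ring isomorphism $\varphi : S \to R$ (a bijection that preserves addition and the bracket, with no continuity assumed) is a homeomorphism. \textbf{Theorem.} Let $\mathcal{A}(\mathbb{C})$ be the additive group of entire functions $\mathbb{C} \to \mathbb{C}$ with pointwise addition, the bracket $[f,g] = fg' - f'g$, and the compact-open topology (uniform convergence on compact sets). Then $\mathcal{A}(\mathbb{C})$ is an algebraically determined Polish Lie ring. -/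

import Mathlib

universe v

/-- A Polish Lie ring: a Lie ring with a Polish topology for which addition, negation and the
bracket are (jointly) continuous. -/
structure IsPolishLieRing (L : Type*) [LieRing L] [TopologicalSpace L] : Prop where
  polish : PolishSpace L
  topologicalAddGroup : IsTopologicalAddGroup L
  continuous_bracket : Continuous fun p : L × L => ⁅p.1, p.2⁆

/-- A Polish Lie ring `R` is algebraically determined if every abstract Lie ring isomorphism
from a Polish Lie ring onto `R` is a homeomorphism. That `R` is a Polish Lie ring is part of
the notion. The universe `w` of the Polish Lie rings `S` is arbitrary. -/
def IsAlgebraicallyDeterminedLieRing.{w, u} (R : Type u) [LieRing R] [TopologicalSpace R] :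
    Prop :=
  IsPolishLieRing R ∧
    ∀ (S : Type w) [LieRing S] [TopologicalSpace S], IsPolishLieRing S →
      ∀ φ : S ≃+ R, (∀ x y : S, φ ⁅x, y⁆ = ⁅φ x, φ y⁆) → IsHomeomorph φ

/-- The additive group of entire functions, inside the continuous functions `ℂ → ℂ`. -/
def entireAddSubgroup : AddSubgroup C(ℂ, ℂ) where
  carrier := {f | Differentiable ℂ f}
  add_mem' hf hg := Differentiable.add hf hg
  zero_mem' := differentiable_const (0 : ℂ)
  neg_mem' hf := Differentiable.neg hf

/-- The entire functions, with pointwise addition and the topology of uniform convergence on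
compact sets (induced from the compact-open topology of `C(ℂ, ℂ)`). -/
def EntireFunction : Type := entireAddSubgroup

namespace EntireFunction

noncomputable instance : AddCommGroup EntireFunction :=
  inferInstanceAs (AddCommGroup entireAddSubgroup)

noncomputable instance : TopologicalSpace EntireFunction :=
  inferInstanceAs (TopologicalSpace entireAddSubgroup)

noncomputable instance : FunLike EntireFunction ℂ ℂ where
  coe f := f.1
  coe_injective := fun _ _ h => Subtype.ext (DFunLike.coe_injective h)

theorem differentiable (f : EntireFunction) : Differentiable ℂ f := f.2

@[ext]
theorem ext {f g : EntireFunction} (h : ∀ z, f z = g z) : f = g := DFunLike.ext _ _ h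

/-- An entire function from a differentiable function. -/
noncomputable def mk (f : ℂ → ℂ) (hf : Differentiable ℂ f) : EntireFunction := ⟨⟨f, hf.continuous⟩, hf⟩

@[simp]
theorem mk_apply (f : ℂ → ℂ) (hf : Differentiable ℂ f) (z : ℂ) : mk f hf z = f z := rfl

@[simp]
theorem add_apply (f g : EntireFunction) (z : ℂ) : (f + g) z = f z + g z := rfl

@[simp]
theorem zero_apply (z : ℂ) : (0 : EntireFunction) z = 0 := rfl

theorem differentiable_deriv (f : EntireFunction) : Differentiable ℂ (deriv f) :=
  f.differentiable.deriv

/-- The bracket `[f, g] = f g' - f' g`. -/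
noncomputable instance : Bracket EntireFunction EntireFunction where
  bracket f g := mk (fun z => f z * deriv g z - deriv f z * g z)
    ((f.differentiable.mul g.differentiable_deriv).sub
      (f.differentiable_deriv.mul g.differentiable))

@[simp]
theorem bracket_apply (f g : EntireFunction) (z : ℂ) :
    ⁅f, g⁆ z = f z * deriv g z - deriv f z * g z := rfl

theorem deriv_add_apply (f g : EntireFunction) (z : ℂ) :
    deriv (f + g : EntireFunction) z = deriv f z + deriv g z :=
  deriv_add (f.differentiable z) (g.differentiable z)

theorem deriv_bracket_apply (f g : EntireFunction) (z : ℂ) :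
    deriv (⁅f, g⁆ : EntireFunction) z = f z * deriv (deriv g) z - deriv (deriv f) z * g z := by
  have h := (((f.differentiable z).hasDerivAt.mul (g.differentiable_deriv z).hasDerivAt).sub
    ((f.differentiable_deriv z).hasDerivAt.mul (g.differentiable z).hasDerivAt)).deriv
  refine Eq.trans h ?_
  ring

noncomputable instance : LieRing EntireFunction where
  add_lie f g h := by
    ext z
    simp only [bracket_apply, add_apply, deriv_add_apply]
    ring
  lie_add f g h := by
    ext z
    simp only [bracket_apply, add_apply, deriv_add_apply]
    ring
  lie_self f := by
    ext z
    simp only [bracket_apply, zero_apply]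
    ring
  leibniz_lie f g h := by
    ext z
    simp only [bracket_apply, add_apply, deriv_bracket_apply]
    ring

end EntireFunction

/-! A homomorphism of Polish abelian groups with analytic graph is Borel, hence continuous by
Pettis. So for a Lie isomorphism `φ : S ≃+ EntireFunction` it suffices that each `s ↦ φ s z` is
continuous: the graph of `φ` is then closed. Bracketing with `1` is differentiation, and `f ↦ f z`,
with values read as constants, is existentially definable from brackets (`constHom_eval_eq_iff`).
Its transport to `S` has analytic graph, so it is continuous. This does not yet see the topology of
`ℂ`, which growth of Taylor coefficients supplies: `‖c‖ ≤ 1` exactly when some entire function has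
`n`-th derivative `c ^ (n ^ 2)` at `0` for all `n`. The derivatives at `0` embed `S` in `ℕ → S`
continuously and injectively, so by Lusin–Souslin the range is Borel, and so is `{s | ‖φ s 0‖ ≤ 1}`.
Pettis then makes `s ↦ φ s 0` continuous. -/

open Set Filter Topology MeasureTheory

/-! ### Automatic continuity in Polish groups -/

/-- **Pettis' lemma**: the differences of a nonmeagre Borel set form a neighbourhood of zero. -/
theorem MeasurableSet.sub_mem_nhds_zero_of_not_isMeagre {G : Type*} [AddCommGroup G]
    [TopologicalSpace G] [IsTopologicalAddGroup G] [BaireSpace G] [MeasurableSpace G]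
    [BorelSpace G] {A : Set G} (hA : MeasurableSet A) (hm : ¬ IsMeagre A) :
    {x | ∃ a ∈ A, ∃ b ∈ A, x = a - b} ∈ 𝓝 (0 : G) := by
  obtain ⟨U, hU, hAU⟩ := hA.residualEq_isOpen
  have hne : U.Nonempty := by
    rw [nonempty_iff_ne_empty]
    rintro rfl
    refine hm ?_
    filter_upwards [eventuallyEq_set.1 hAU] with x hx using by simpa using hx
  obtain ⟨u, hu⟩ := hne
  have hV : {x : G | x + u ∈ U} ∈ 𝓝 (0 : G) := by
    have : ContinuousAt (fun x : G => x + u) 0 := by fun_prop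
    exact this (hU.mem_nhds (by simpa using hu))
  filter_upwards [hV] with x hx
  have h1 : {y | y ∈ A ↔ y ∈ U} ∈ residual G := eventuallyEq_set.1 hAU
  have h2 : {y | x + y ∈ A ↔ x + y ∈ U} ∈ residual G :=
    tendsto_residual_of_isOpenMap (Homeomorph.addLeft x).continuous
      (Homeomorph.addLeft x).isOpenMap h1
  have hO : IsOpen {y | y ∈ U ∧ x + y ∈ U} :=
    hU.inter (hU.preimage (continuous_const.add continuous_id))
  have h3 : Dense ({y | y ∈ A ↔ y ∈ U} ∩ {y | x + y ∈ A ↔ x + y ∈ U}) :=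
    dense_of_mem_residual (inter_mem h1 h2)
  obtain ⟨y, ⟨hy1, hy2⟩, hy3, hy4⟩ := h3.inter_open_nonempty _ hO ⟨u, hu, hx⟩
  exact ⟨x + y, hy4.2 hy2, y, hy3.2 hy1, by abel⟩

/-- A homomorphism to a second countable group is continuous as soon as the preimages of
arbitrarily small neighbourhoods of zero are Borel. -/
theorem AddMonoidHom.continuous_of_measurableSet_preimage {G H : Type*} [AddCommGroup G]
    [TopologicalSpace G] [IsTopologicalAddGroup G] [BaireSpace G] [MeasurableSpace G]
    [BorelSpace G] [AddCommGroup H] [TopologicalSpace H] [IsTopologicalAddGroup H]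
    [SecondCountableTopology H] (f : G →+ H)
    (hf : ∀ V ∈ 𝓝 (0 : H), ∃ W ∈ 𝓝 (0 : H), W ⊆ V ∧ MeasurableSet (f ⁻¹' W)) :
    Continuous f := by
  refine continuous_of_continuousAt_zero f ?_
  intro V hV
  rw [map_zero] at hV
  have hsub : ∀ᶠ p : H × H in 𝓝 (0, 0), p.1 - p.2 ∈ V := by
    have : ContinuousAt (fun p : H × H => p.1 - p.2) (0, 0) := by fun_prop
    exact this (by simpa using hV)
  rw [nhds_prod_eq] at hsub
  obtain ⟨V', hV', hVV⟩ := mem_prod_same_iff.1 hsub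
  obtain ⟨W, hW, hWV, hWm⟩ := hf V' hV'
  have hm : ¬ IsMeagre (f ⁻¹' W) := by
    intro hmeagre
    -- Centres are taken in the range of `f`, so that the covering sets pull back to translates of
    -- `f ⁻¹' W` in `G`.
    obtain ⟨t, ht, htu⟩ := TopologicalSpace.countable_cover_nhds (α := Set.range f)
      (f := fun y => {x | (x : H) - y ∈ W}) (fun y => by
        have : ContinuousAt (fun x : Set.range f => (x : H) - y) y := by fun_prop
        exact this (by simpa using hW))
    have hcover : ⋃ y ∈ t, {g : G | f g - y ∈ W} = univ := by
      refine eq_univ_of_forall fun g => ?_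
      have := htu.ge (mem_univ (⟨f g, g, rfl⟩ : Set.range f))
      simpa using this
    have : IsMeagre (univ : Set G) := by
      rw [← hcover, biUnion_eq_iUnion]
      have := ht.to_subtype
      refine isMeagre_iUnion fun y => ?_
      obtain ⟨⟨_, g, rfl⟩, _⟩ := y
      have := hmeagre.preimage_of_isOpenMap (Homeomorph.subRight g).continuous
        (Homeomorph.subRight g).isOpenMap
      simpa [preimage, ← map_sub] using this
    exact not_isMeagre_of_isOpen isOpen_univ univ_nonempty this
  rw [mem_map]
  filter_upwards [hWm.sub_mem_nhds_zero_of_not_isMeagre hm]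
  rintro _ ⟨a, ha, b, hb, rfl⟩
  have := hVV (mk_mem_prod (hWV ha) (hWV hb))
  simpa using this

theorem MeasureTheory.AnalyticSet.inter_of_measurableSet {X : Type*} [TopologicalSpace X]
    [PolishSpace X] [MeasurableSpace X] [BorelSpace X] {s t : Set X} (hs : AnalyticSet s)
    (ht : MeasurableSet t) : AnalyticSet (s ∩ t) := by
  rw [inter_eq_iInter]
  exact AnalyticSet.iInter (by rintro (_ | _); exacts [ht.analyticSet, hs])

/-- A function between Polish spaces with analytic graph is Borel measurable. -/
theorem MeasureTheory.AnalyticSet.measurable_of_graph {X Y : Type*} [TopologicalSpace X]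
    [PolishSpace X] [MeasurableSpace X] [BorelSpace X] [TopologicalSpace Y] [PolishSpace Y]
    [MeasurableSpace Y] [BorelSpace Y] {f : X → Y} (hf : AnalyticSet {p : X × Y | f p.1 = p.2}) :
    Measurable f := by
  have key : ∀ t : Set Y, MeasurableSet t → AnalyticSet (f ⁻¹' t) := by
    intro t ht
    convert (hf.inter_of_measurableSet (measurable_snd ht)).image_of_continuous continuous_fst
    ext x
    constructor
    · intro hx
      exact ⟨(x, f x), ⟨rfl, hx⟩, rfl⟩
    · rintro ⟨⟨x, y⟩, ⟨hxy, hy⟩, rfl⟩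
      exact (congrArg (· ∈ t) hxy).mpr hy
  -- Souslin: an analytic set with analytic complement is Borel.
  exact fun t ht => (key t ht).measurableSet_of_compl (key tᶜ ht.compl)

/-- **Automatic continuity**: a homomorphism between Polish groups with analytic graph is
continuous. -/
theorem AddMonoidHom.continuous_of_analyticSet_graph {G H : Type*} [AddCommGroup G]
    [TopologicalSpace G] [IsTopologicalAddGroup G] [PolishSpace G] [AddCommGroup H]
    [TopologicalSpace H] [IsTopologicalAddGroup H] [PolishSpace H] (f : G →+ H)
    (hf : AnalyticSet {p : G × H | f p.1 = p.2}) : Continuous f := by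
  borelize G H
  refine f.continuous_of_measurableSet_preimage fun V hV => ?_
  obtain ⟨W, hWV, hW, h0⟩ := mem_nhds_iff.1 hV
  exact ⟨W, hW.mem_nhds h0, hWV, hf.measurable_of_graph hW.measurableSet⟩

/-! ### The Polish topology on entire functions -/

namespace EntireFunction

theorem isEmbedding_val : IsEmbedding (fun f : EntireFunction => (f.1 : C(ℂ, ℂ))) :=
  IsEmbedding.subtypeVal

theorem tendsto_iff {ι : Type*} {l : Filter ι} {F : ι → EntireFunction} {f : EntireFunction} :
    Tendsto F l (𝓝 f) ↔ TendstoLocallyUniformlyOn (fun i z => F i z) f l univ := by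
  rw [isEmbedding_val.tendsto_nhds_iff, ContinuousMap.tendsto_iff_tendstoLocallyUniformly,
    tendstoLocallyUniformlyOn_univ]
  rfl

theorem continuous_eval (z : ℂ) : Continuous fun f : EntireFunction => f z :=
  (continuous_eval_const (F := C(ℂ, ℂ)) z).comp isEmbedding_val.continuous

theorem isClosed_entireAddSubgroup : IsClosed (entireAddSubgroup : Set C(ℂ, ℂ)) := by
  refine isClosed_of_closure_subset fun f hf => ?_
  have h := mem_closure_iff_comap_neBot.1 hf
  have ht : Tendsto (fun g : entireAddSubgroup => (g : C(ℂ, ℂ)))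
      (comap (fun g : entireAddSubgroup => (g : C(ℂ, ℂ))) (𝓝 f)) (𝓝 f) := tendsto_comap
  rw [ContinuousMap.tendsto_iff_tendstoLocallyUniformly, ← tendstoLocallyUniformlyOn_univ] at ht
  exact differentiableOn_univ.1 (ht.differentiableOn
    (Eventually.of_forall fun g => g.2.differentiableOn) isOpen_univ)

instance : PolishSpace C(ℂ, ℂ) where
  toIsCompletelyMetrizableSpace := inferInstance

instance : PolishSpace EntireFunction := isClosed_entireAddSubgroup.polishSpace

instance : IsTopologicalAddGroup EntireFunction :=
  inferInstanceAs (IsTopologicalAddGroup entireAddSubgroup)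

/-- The derivative of an entire function, as an entire function. -/
noncomputable def derivative (f : EntireFunction) : EntireFunction :=
  mk (deriv f) f.differentiable_deriv

theorem continuous_derivative : Continuous derivative := by
  refine continuous_iff_continuousAt.2 fun f => tendsto_iff.2 ?_
  exact (tendsto_iff.1 (tendsto_id (x := 𝓝 f))).deriv
    (Eventually.of_forall fun g => g.differentiable.differentiableOn) isOpen_univ

theorem continuous_bracket :
    Continuous fun p : EntireFunction × EntireFunction => ⁅p.1, p.2⁆ := by
  refine isEmbedding_val.continuous_iff.2 ?_
  have hv := isEmbedding_val.continuous
  have hd := hv.comp continuous_derivative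
  exact (((hv.comp continuous_fst).mul (hd.comp continuous_snd)).sub
    ((hd.comp continuous_fst).mul (hv.comp continuous_snd)))

theorem isPolishLieRing : IsPolishLieRing EntireFunction :=
  ⟨inferInstance, inferInstance, continuous_bracket⟩

/-! ### Evaluation expressed by brackets -/

/-- Evaluation at a point. -/
noncomputable def evalHom (z : ℂ) : EntireFunction →+ ℂ where
  toFun f := f z
  map_zero' := rfl
  map_add' _ _ := rfl

/-- The constant functions. -/
noncomputable def constHom : ℂ →+ EntireFunction where
  toFun c := mk (fun _ => c) (differentiable_const c)
  map_zero' := rfl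
  map_add' _ _ := rfl

/-- The functions `w ↦ c * w`. -/
noncomputable def linearHom : ℂ →+ EntireFunction where
  toFun c := mk (fun w => c * w) (differentiable_id.const_mul c)
  map_zero' := by ext w; simp
  map_add' a b := by ext w; simp [add_mul]

@[simp] theorem evalHom_apply (z : ℂ) (f : EntireFunction) : evalHom z f = f z := rfl

@[simp] theorem constHom_apply (c w : ℂ) : constHom c w = c := rfl

@[simp] theorem linearHom_apply (c w : ℂ) : linearHom c w = c * w := rfl

@[simp] theorem deriv_constHom (c : ℂ) : deriv (constHom c) = fun _ => 0 := deriv_const' c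

@[simp] theorem deriv_linearHom (c : ℂ) : deriv (linearHom c) = fun _ => c := by
  ext w
  exact (((hasDerivAt_id w).const_mul c).deriv).trans (mul_one c)

theorem deriv_sub_apply (f g : EntireFunction) (z : ℂ) :
    deriv (f - g : EntireFunction) z = deriv f z - deriv g z :=
  deriv_sub (f.differentiable z) (g.differentiable z)

theorem sub_apply (f g : EntireFunction) (z : ℂ) : (f - g) z = f z - g z := rfl

@[simp] theorem bracket_one_apply (f : EntireFunction) (w : ℂ) : ⁅constHom 1, f⁆ w = deriv f w := by
  simp

theorem iterate_bracket_one_apply (f : EntireFunction) (n : ℕ) (w : ℂ) :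
    ((fun g => ⁅constHom 1, g⁆)^[n] f) w = iteratedDeriv n f w := by
  induction n generalizing w with
  | zero => rfl
  | succ n ih =>
    rw [Function.iterate_succ_apply', bracket_one_apply, iteratedDeriv_succ, funext ih]

theorem exists_primitive (f : EntireFunction) : ∃ g : EntireFunction, ∀ w, deriv g w = f w := by
  obtain ⟨g, hg⟩ := f.differentiable.isExactOn_univ
  exact ⟨mk g fun w => (hg w (mem_univ w)).differentiableAt, fun w => (hg w (mem_univ w)).deriv⟩

theorem exists_eq_const_add (f : EntireFunction) (z : ℂ) :
    ∃ g : EntireFunction, ∀ w, f w = (w - z) * g w + f z := by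
  refine ⟨mk (dslope f z) ?_, fun w => ?_⟩
  · rw [← differentiableOn_univ]
    exact (Complex.differentiableOn_dslope univ_mem).2 f.differentiable.differentiableOn
  · have := sub_smul_dslope f z w
    simp only [smul_eq_mul] at this
    simp [this]

/-- Differentiating `[w - z, b] = 0` gives `(w - z) b'' = 0`, so `b''` vanishes off `z`, and at `z`
by continuity. -/
theorem deriv_eq_const_of_bracket_eq_zero {z : ℂ} {b : EntireFunction}
    (hb : ⁅linearHom 1 - constHom z, b⁆ = 0) (w : ℂ) : deriv b w = deriv b z := by
  have h1 : ∀ w, (w - z) * deriv (deriv b) w = 0 := by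
    intro w
    have : (⁅constHom 1, ⁅linearHom 1 - constHom z, b⁆⁆ : EntireFunction) w = 0 := by
      rw [hb, lie_zero, zero_apply]
    rw [bracket_one_apply, deriv_bracket_apply, sub_apply] at this
    have h2 : deriv (linearHom 1 - constHom z : EntireFunction) = fun _ => 1 := by
      ext w
      simp [deriv_sub_apply]
    simpa [h2] using this
  have h2 : deriv (deriv b) = fun _ => 0 := by
    refine Continuous.ext_on (dense_compl_singleton z) ?_ continuous_const fun w hw => ?_
    · exact b.differentiable_deriv.deriv.continuous
    · simpa [sub_ne_zero.2 hw] using h1 w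
  exact is_const_of_deriv_eq_zero b.differentiable_deriv (fun w => congrFun h2 w) w z

/-- Evaluation at `z` in terms of the bracket. -/
theorem constHom_eval_eq_iff (z : ℂ) (h k : EntireFunction) :
    constHom (h z) = k ↔ ∃ g b : EntireFunction, ⁅linearHom 1 - constHom z, b⁆ = 0 ∧
      ⁅constHom 1, ⁅linearHom 1 - constHom z, g⁆ + b⁆ = h ∧ ⁅constHom 1, b⁆ = k := by
  have h2 : deriv (linearHom 1 - constHom z : EntireFunction) = fun _ => 1 := by
    ext w
    simp [deriv_sub_apply]
  have key : ∀ (g b : EntireFunction) (w : ℂ),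
      ⁅constHom 1, ⁅linearHom 1 - constHom z, g⁆ + b⁆ w
        = (w - z) * deriv (deriv g) w + deriv b w := by
    intro g b w
    rw [bracket_one_apply, deriv_add_apply, deriv_bracket_apply, sub_apply, h2]
    simp
  constructor
  · rintro rfl
    -- Since `[w - z, g]' = (w - z) g''`, write `h = (w - z) q + h z` and take for `g` a second
    -- primitive of `q`, with `b = h z * (w - z)`.
    obtain ⟨q, hq⟩ := h.exists_eq_const_add z
    obtain ⟨r, hr⟩ := q.exists_primitive
    obtain ⟨g, hg⟩ := r.exists_primitive
    have hb : ∀ w, deriv (linearHom (h z) - constHom (h z * z) : EntireFunction) w = h z := by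
      intro w
      simp [deriv_sub_apply]
    refine ⟨g, linearHom (h z) - constHom (h z * z), ?_, ?_, ?_⟩
    · ext w
      rw [bracket_apply, h2, hb]
      simp only [sub_apply, linearHom_apply, constHom_apply, zero_apply]
      ring
    · ext w
      rw [key, hb, funext hg, hr]
      exact (hq w).symm
    · ext w
      rw [bracket_one_apply, hb, constHom_apply]
  · rintro ⟨g, b, hb, rfl, rfl⟩
    ext w
    rw [constHom_apply, key, bracket_one_apply, deriv_eq_const_of_bracket_eq_zero hb w]
    simp

/-- The correspondence between constant and linear functions in terms of the bracket. -/
theorem linearHom_eval_eq_iff (f k : EntireFunction) :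
    linearHom (f 0) = k ↔ constHom (f 0) = ⁅constHom 1, k⁆ ∧ ⁅linearHom 1, k⁆ = 0 := by
  constructor
  · rintro rfl
    constructor <;> ext w <;> simp
    ring
  · rintro ⟨h1, h2⟩
    ext w
    have h3 := DFunLike.congr_fun h1 w
    have h4 := DFunLike.congr_fun h2 w
    rw [constHom_apply, bracket_one_apply] at h3
    rw [bracket_apply, ← h3, deriv_linearHom, linearHom_apply, zero_apply] at h4
    rw [linearHom_apply]
    linear_combination h4

/-! ### Taylor coefficients and the unit disc -/

theorem eq_of_iteratedDeriv_eq {f g : EntireFunction}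
    (h : ∀ n, iteratedDeriv n f 0 = iteratedDeriv n g 0) : f = g := by
  ext z
  rw [← Complex.taylorSeries_eq_of_entire f.differentiable 0 z,
    ← Complex.taylorSeries_eq_of_entire g.differentiable 0 z]
  simp only [h]

theorem exists_iteratedDeriv_eq_of_norm_le_one {a : ℕ → ℂ} (ha : ∀ n, ‖a n‖ ≤ 1) :
    ∃ f : EntireFunction, ∀ n, iteratedDeriv n f 0 = a n := by
  let p := FormalMultilinearSeries.ofScalars ℂ (fun n => a n / (n.factorial : ℂ))
  have hp : p.radius = ⊤ := by
    refine p.radius_eq_top_of_summable_norm fun r => ?_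
    refine Summable.of_nonneg_of_le (fun n => by positivity) (fun n => ?_)
      (Real.summable_pow_div_factorial r)
    rw [FormalMultilinearSeries.ofScalars_norm, norm_div, Complex.norm_natCast, div_mul_eq_mul_div]
    gcongr
    exact mul_le_of_le_one_left (by positivity) (ha n)
  have hs : HasFPowerSeriesOnBall p.sum p 0 ⊤ := hp ▸ p.hasFPowerSeriesOnBall (by simp [hp])
  have hd : Differentiable ℂ p.sum := by
    rw [← differentiableOn_univ]
    simpa using hs.differentiableOn
  refine ⟨mk p.sum hd, fun n => ?_⟩
  have := hs.factorial_smul 1 n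
  change iteratedDeriv n p.sum 0 = _
  rw [iteratedDeriv_eq_iteratedFDeriv, ← this]
  have hn : (n.factorial : ℂ) ≠ 0 := by exact_mod_cast n.factorial_ne_zero
  simp [p, FormalMultilinearSeries.ofScalars, mul_div_cancel₀, hn]

/-- The closed unit disc is characterized by the derivatives of entire functions at zero. -/
theorem exists_iteratedDeriv_eq_pow_sq_iff (c : ℂ) :
    (∃ f : EntireFunction, ∀ n, iteratedDeriv n f 0 = c ^ (n ^ 2)) ↔ ‖c‖ ≤ 1 := by
  constructor
  · rintro ⟨f, hf⟩
    by_contra! hc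
    obtain ⟨M, hM⟩ := (isCompact_sphere (0 : ℂ) 1).exists_bound_of_continuousOn
      f.differentiable.continuous.continuousOn
    -- Cauchy's estimate on the unit circle; `‖c‖ ^ (n ^ 2)` outgrows `n! * M` when `‖c‖ > 1`.
    have hb : ∀ n : ℕ, ‖c‖ ^ (n ^ 2) ≤ n.factorial * M := by
      intro n
      have := Complex.norm_iteratedDeriv_le_of_forall_mem_sphere_norm_le n one_pos
        f.differentiable.diffContOnCl hM
      simpa [hf] using this
    have hM0 : 0 < M := by simpa using (show (0 : ℝ) < 1 by norm_num).trans_le (hb 0)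
    have h0 : Tendsto (fun n : ℕ => (n : ℝ) / ‖c‖ ^ n) atTop (𝓝 0) := by
      simpa using tendsto_pow_const_div_const_pow_of_one_lt 1 hc
    -- The bound `1` lets the `n`-th power be dropped; `1 / (2 * M)` then forces the quantity in
    -- `h2` below `1 / 2`.
    have hε : (0 : ℝ) < min 1 (1 / (2 * M)) := by positivity
    obtain ⟨n, hn, hn1⟩ := ((h0.eventually_lt_const hε).and (eventually_ge_atTop 1)).exists
    have hpos : 0 < ‖c‖ ^ n := by positivity
    have h1 : (n.factorial : ℝ) ≤ n ^ n := by exact_mod_cast n.factorial_le_pow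
    have h2 : 1 ≤ ((n : ℝ) / ‖c‖ ^ n) ^ n * M := by
      rw [div_pow, ← pow_mul, ← sq, div_mul_eq_mul_div, one_le_div (by positivity)]
      exact (hb n).trans (by gcongr)
    have h3 : ((n : ℝ) / ‖c‖ ^ n) ^ n ≤ (n : ℝ) / ‖c‖ ^ n :=
      pow_le_of_le_one (by positivity) (hn.le.trans (min_le_left _ _)) (by omega)
    have h4 : ((n : ℝ) / ‖c‖ ^ n) * M < 1 / (2 * M) * M :=
      mul_lt_mul_of_pos_right (hn.trans_le (min_le_right _ _)) hM0
    have h5 : 1 / (2 * M) * M = 1 / 2 := by field_simp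
    nlinarith
  · intro hc
    exact exists_iteratedDeriv_eq_of_norm_le_one fun n => by
      rw [norm_pow]
      exact pow_le_one₀ (norm_nonneg c) hc

end EntireFunction

/-! ### Transport to an isomorphic Polish Lie ring -/

namespace EntireFunction

variable {S : Type*} [LieRing S]

theorem symm_map_bracket {φ : S ≃+ EntireFunction} (hφ : ∀ x y : S, φ ⁅x, y⁆ = ⁅φ x, φ y⁆)
    (f g : EntireFunction) : φ.symm ⁅f, g⁆ = ⁅φ.symm f, φ.symm g⁆ := by
  rw [AddEquiv.symm_apply_eq, hφ, φ.apply_symm_apply, φ.apply_symm_apply]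

variable [TopologicalSpace S]

/-- Evaluation at a point, followed by the embedding of the constants, is continuous in every
Polish Lie ring isomorphic to the entire functions. -/
theorem continuous_symm_constHom_eval (hS : IsPolishLieRing S) {φ : S ≃+ EntireFunction}
    (hφ : ∀ x y : S, φ ⁅x, y⁆ = ⁅φ x, φ y⁆) (z : ℂ) :
    Continuous fun s => φ.symm (constHom (φ s z)) := by
  have := hS.polish
  have := hS.topologicalAddGroup
  have hbr : ∀ x : S, Continuous fun y : S => ⁅x, y⁆ := fun x =>
    hS.continuous_bracket.comp (continuous_const.prodMk continuous_id)
  refine AddMonoidHom.continuous_of_analyticSet_graph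
    (φ.symm.toAddMonoidHom.comp (constHom.comp ((evalHom z).comp φ.toAddMonoidHom))) ?_
  set e := φ.symm (constHom 1)
  set l := φ.symm (linearHom 1 - constHom z)
  -- The graph is the image under this map of the closed set of pairs `(g, b)` with `[l, b] = 0`.
  have hF : Continuous fun p : S × S => ((⁅e, ⁅l, p.1⁆ + p.2⁆ : S), (⁅e, p.2⁆ : S)) :=
    ((hbr e).comp (((hbr l).comp continuous_fst).add continuous_snd)).prodMk
      ((hbr e).comp continuous_snd)
  have hcl : IsClosed {p : S × S | ⁅l, p.2⁆ = 0} :=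
    isClosed_eq ((hbr l).comp continuous_snd) continuous_const
  convert hcl.analyticSet.image_of_continuous hF using 1
  ext ⟨s, t⟩
  change φ.symm (constHom (φ s z)) = t ↔ _
  rw [AddEquiv.symm_apply_eq, constHom_eval_eq_iff]
  simp only [mem_image, mem_ofPred_eq, Prod.mk.injEq, Prod.exists]
  constructor
  · rintro ⟨g, b, h1, h2, h3⟩
    refine ⟨φ.symm g, φ.symm b, ?_, ?_, ?_⟩
    · rw [← symm_map_bracket hφ, h1, map_zero]
    · rw [← symm_map_bracket hφ, ← map_add, ← symm_map_bracket hφ, h2, φ.symm_apply_apply]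
    · rw [← symm_map_bracket hφ, h3, φ.symm_apply_apply]
  · rintro ⟨g, b, h1, h2, h3⟩
    have he : φ e = constHom 1 := φ.apply_symm_apply _
    have hl : φ l = linearHom 1 - constHom z := φ.apply_symm_apply _
    refine ⟨φ g, φ b, ?_, ?_, ?_⟩
    · rw [← hl, ← hφ, h1, map_zero]
    · rw [← hl, ← he, ← hφ, ← map_add, ← hφ, h2]
    · rw [← he, ← hφ, h3]

theorem continuous_symm_linearHom_eval (hS : IsPolishLieRing S) {φ : S ≃+ EntireFunction}
    (hφ : ∀ x y : S, φ ⁅x, y⁆ = ⁅φ x, φ y⁆) :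
    Continuous fun s => φ.symm (linearHom (φ s 0)) := by
  have := hS.polish
  have := hS.topologicalAddGroup
  have hbr : ∀ x : S, Continuous fun y : S => ⁅x, y⁆ := fun x =>
    hS.continuous_bracket.comp (continuous_const.prodMk continuous_id)
  refine AddMonoidHom.continuous_of_analyticSet_graph
    (φ.symm.toAddMonoidHom.comp (linearHom.comp ((evalHom 0).comp φ.toAddMonoidHom))) ?_
  refine IsClosed.analyticSet ?_
  have hcl : IsClosed {p : S × S | φ.symm (constHom (φ p.1 0)) = ⁅φ.symm (constHom 1), p.2⁆ ∧
      ⁅φ.symm (linearHom 1), p.2⁆ = 0} :=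
    (isClosed_eq ((continuous_symm_constHom_eval hS hφ 0).comp continuous_fst)
      ((hbr _).comp continuous_snd)).inter
      (isClosed_eq ((hbr _).comp continuous_snd) continuous_const)
  convert hcl using 1
  ext ⟨s, t⟩
  change φ.symm (linearHom (φ s 0)) = t ↔ φ.symm (constHom (φ s 0)) = ⁅φ.symm (constHom 1), t⁆ ∧
      ⁅φ.symm (linearHom 1), t⁆ = 0
  rw [AddEquiv.symm_apply_eq, linearHom_eval_eq_iff, AddEquiv.symm_apply_eq, hφ,
    φ.apply_symm_apply, ← φ.map_eq_zero_iff (x := ⁅φ.symm (linearHom 1), t⁆), hφ,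
    φ.apply_symm_apply]

/-- Brackets multiply constants: `[a, b w] = a b`. -/
theorem continuous_symm_constHom_eval_pow (hS : IsPolishLieRing S) {φ : S ≃+ EntireFunction}
    (hφ : ∀ x y : S, φ ⁅x, y⁆ = ⁅φ x, φ y⁆) (n : ℕ) :
    Continuous fun s => φ.symm (constHom (φ s 0 ^ n)) := by
  induction n with
  | zero => simpa using continuous_const
  | succ n ih =>
    have h := hS.continuous_bracket.comp ((continuous_symm_constHom_eval hS hφ 0).prodMk
      ((continuous_symm_linearHom_eval hS hφ).comp ih))
    refine h.congr fun s => ?_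
    simp only [Function.comp_apply, φ.apply_symm_apply, constHom_apply]
    rw [← symm_map_bracket hφ]
    congr 1
    ext w
    simp [pow_succ']

theorem measurableSet_norm_eval_le_one [MeasurableSpace S] [BorelSpace S]
    (hS : IsPolishLieRing S) {φ : S ≃+ EntireFunction}
    (hφ : ∀ x y : S, φ ⁅x, y⁆ = ⁅φ x, φ y⁆) : MeasurableSet {s | ‖φ s 0‖ ≤ 1} := by
  have := hS.polish
  have hD : Continuous fun s : S => ⁅φ.symm (constHom 1), s⁆ :=
    hS.continuous_bracket.comp (continuous_const.prodMk continuous_id)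
  have hDn : ∀ (n : ℕ) (s : S), φ ((fun s : S => ⁅φ.symm (constHom 1), s⁆)^[n] s) 0
      = iteratedDeriv n (φ s) 0 := by
    intro n s
    rw [← iterate_bracket_one_apply]
    have : Function.Semiconj φ (fun s : S => ⁅φ.symm (constHom 1), s⁆)
        (fun g => ⁅constHom 1, g⁆) := fun s => by rw [hφ, φ.apply_symm_apply]
    rw [(this.iterate_right n).eq s]
  let T : S → ℕ → S := fun s n =>
    φ.symm (constHom (φ ((fun s : S => ⁅φ.symm (constHom 1), s⁆)^[n] s) 0))
  have hT : Continuous T := continuous_pi fun n =>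
    (continuous_symm_constHom_eval hS hφ 0).comp (hD.iterate n)
  have hconst : ∀ {a b : ℂ}, φ.symm (constHom a) = φ.symm (constHom b) ↔ a = b := fun {a b} =>
    ⟨fun h => DFunLike.congr_fun (φ.symm.injective h) 0, fun h => by rw [h]⟩
  have hTi : Function.Injective T := by
    intro s t hst
    refine φ.injective (eq_of_iteratedDeriv_eq fun n => ?_)
    rw [← hDn, ← hDn]
    exact hconst.1 (congrFun hst n)
  have hQ : Continuous fun (s : S) (n : ℕ) => φ.symm (constHom (φ s 0 ^ (n ^ 2))) :=
    continuous_pi fun n => continuous_symm_constHom_eval_pow hS hφ (n ^ 2)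
  -- The range of `T` is Borel by Lusin–Souslin.
  convert hQ.measurable (measurableSet_range_of_continuous_injective hT hTi) using 1
  ext s
  rw [mem_ofPred_eq, ← exists_iteratedDeriv_eq_pow_sq_iff, mem_preimage, mem_range]
  constructor
  · rintro ⟨f, hf⟩
    refine ⟨φ.symm f, funext fun n => hconst.2 ?_⟩
    rw [hDn, φ.apply_symm_apply, hf]
  · rintro ⟨t, ht⟩
    exact ⟨φ t, fun n => by rw [← hDn]; exact hconst.1 (congrFun ht n)⟩

theorem continuous_eval_comp (hS : IsPolishLieRing S) {φ : S ≃+ EntireFunction}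
    (hφ : ∀ x y : S, φ ⁅x, y⁆ = ⁅φ x, φ y⁆) (z : ℂ) : Continuous fun s => φ s z := by
  have := hS.polish
  have := hS.topologicalAddGroup
  have h0 : Continuous fun s => φ s 0 := by
    borelize S
    refine AddMonoidHom.continuous_of_measurableSet_preimage
      ((evalHom 0).comp φ.toAddMonoidHom) fun V hV => ?_
    obtain ⟨ε, hε, hV⟩ := Metric.mem_nhds_iff.1 hV
    obtain ⟨n, hn⟩ := exists_nat_one_div_lt hε
    refine ⟨Metric.closedBall 0 (1 / (n + 1)), Metric.closedBall_mem_nhds _ (by positivity),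
      (Metric.closedBall_subset_ball hn).trans hV, ?_⟩
    -- Multiplication by the integer `n + 1`, available in `S`, reduces radius `1 / (n + 1)` to the
    -- unit disc.
    convert (continuous_const_smul (n + 1)).measurable (measurableSet_norm_eval_le_one hS hφ)
      using 1
    ext s
    have h : φ ((n + 1) • s) 0 = ((n + 1 : ℕ) : ℂ) * φ s 0 := by
      rw [← nsmul_eq_mul, ← evalHom_apply, ← evalHom_apply, map_nsmul, map_nsmul]
    rw [mem_preimage, mem_preimage, mem_ofPred_eq, h, mem_closedBall_zero_iff, norm_mul,
      Complex.norm_natCast, le_div_iff₀ (by positivity), mul_comm, Nat.cast_add_one]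
    rfl
  -- The value at `z` is the value at `0` of the constant function `φ s z`.
  exact (h0.comp (continuous_symm_constHom_eval hS hφ z)).congr fun s => by simp

theorem isHomeomorph_of_map_bracket (hS : IsPolishLieRing S) (φ : S ≃+ EntireFunction)
    (hφ : ∀ x y : S, φ ⁅x, y⁆ = ⁅φ x, φ y⁆) : IsHomeomorph φ := by
  have := hS.polish
  have := hS.topologicalAddGroup
  have hcl : IsClosed {p : S × EntireFunction | φ p.1 = p.2} := by
    have : {p : S × EntireFunction | φ p.1 = p.2} = ⋂ z, {p | φ p.1 z = p.2 z} := by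
      ext p
      simp [DFunLike.ext_iff]
    rw [this]
    exact isClosed_iInter fun z => isClosed_eq
      ((continuous_eval_comp hS hφ z).comp continuous_fst)
      ((continuous_eval z).comp continuous_snd)
  have h1 : Continuous φ := φ.toAddMonoidHom.continuous_of_analyticSet_graph hcl.analyticSet
  have h2 : Continuous φ.symm := by
    refine φ.symm.toAddMonoidHom.continuous_of_analyticSet_graph ?_
    convert (hcl.preimage continuous_swap).analyticSet using 1
    ext ⟨f, s⟩
    change φ.symm f = s ↔ φ s = f
    rw [AddEquiv.symm_apply_eq, eq_comm]
  exact (Homeomorph.mk φ.toEquiv h1 h2).isHomeomorph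

end EntireFunction

theorem mainTheorem7 : IsAlgebraicallyDeterminedLieRing.{v, 0} EntireFunction :=
  ⟨EntireFunction.isPolishLieRing, fun _ _ _ hS φ hφ =>
    EntireFunction.isHomeomorph_of_map_bracket hS φ hφ⟩
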